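/- Consider the two-stage robust optimization problem with decision-dependent uncertainty $$\mathbf{2\text{-}Stg\ RO}:\quad w^*=\min_{\mathbf x\in\mathcal X}\ \mathbf c_1\mathbf x+\max_{\mathbf u\in\mathcal U(\mathbf x)}\ \min_{\mathbf y\in\mathcal Y(\mathbf x,\mathbf u)}\mathbf c_2\mathbf y ,$$ where $\mathcal X=\{\mathbf x\in\mathbb Z_+^{m_x}\times\mathbb R_+^{n_x}:\mathbf A\mathbf x\ge\mathbf b\}$, $\mathcal U(\mathbf x)=\{\mathbf u\in\mathbb R_+^{n_u}:\mathbf F(\mathbf x)\mathbf u\le\mathbf h+\mathbf G\mathbf x\}$ with $\mathbf F$ an arbitrary matrix-valued function of $\mathbf x$, and $\mathcal Y(\mathbf x,\mathbf u)=\{\mathbf y\in\mathbb R_+^{n_y}:\mathbf B_2\mathbf y\ge\mathbf d-\mathbf B_1\mathbf x-\mathbf E\mathbf u\}$. All data are real. A decision $\mathbf x\in\mathcal X$ is feasible if $\mathcal Y(\mathbf x,\mathbf u)\neq\emptyset$ for all $\mathbf u\in\mathcal U(\mathbf x)$. Optimal values are infima (suprema) in $[-\infty,+\infty]$, equal to $+\infty$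 for an infeasible minimization problem. Assume * (A1) $\mathcal U(\mathbf x)\ne\emptyset$ for every $\mathbf x\in\mathcal X$; * (A2) $\mathcal U(\mathbf x)$ is bounded for every $\mathbf x\in\mathcal X$; * (A3) the mixed integer program $\min\{\mathbf c_1\mathbf x+\mathbf c_2\mathbf y:\mathbf x\in\mathcal X,\ \mathbf u\in\mathcal U(\mathbf x),\ \mathbf y\in\mathcal Y(\mathbf x,\mathbf u)\}$ has a finite optimal value. Let $\Pi=\{\boldsymbol\pi\ge\mathbf 0:\mathbf B_2^\intercal\boldsymbol\pi\le\mathbf c_2^\intercal\}$, let $\mathcal P_\Pi$ be the set of extreme points of $\Pi$, and let $\mathcal R_\Pi$ be the set of extreme rays of $\Pi$ (that is, of its recession cone), each given by one arbitrarily chosen generator. Then $\mathcal P_\Pi$ and $\mathcal R_\Pi$ are finite, and $\mathbf{2\text{-}Stg\ RO}$, as well as the bilevel problem $$\min_{\mathbf x\in\mathcal X}\ \mathbf c_1\mathbf x+\max\{(\mathbf d-\mathbf B_1\mathbf x-\mathbf E\mathbf u)^\intercal\boldsymbol\pi:\ \mathbf u\in\mathcal U(\mathbf x),\ \boldsymbol\pi\in\Pi\}$$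 (in which $\mathbf x$ is feasible if the inner maximum is not $+\infty$), is equivalent to the bilevel linear program $$\begin{aligned} \mathbf{2\text{-}Stg\ RO}(\Sigma_\Pi):\quad \min_{\mathbf x,\ \eta\in\mathbb R}\ &\mathbf c_1\mathbf x+\eta\\ \text{s.t. }\ &\mathbf x\in\mathcal X,\\ &\eta\ge(\mathbf d-\mathbf B_1\mathbf x)^\intercal\boldsymbol\pi+\max_{\mathbf u\in\mathcal U(\mathbf x)}(-\mathbf E\mathbf u)^\intercal\boldsymbol\pi\qquad\forall\boldsymbol\pi\in\mathcal P_\Pi,\\ &(\mathbf d-\mathbf B_1\mathbf x)^\intercal\boldsymbol\gamma+\max_{\mathbf v\in\mathcal U(\mathbf x)}(-\mathbf E\mathbf v)^\intercal\boldsymbol\gamma\le 0\qquad\forall\boldsymbol\gamma\in\mathcal R_\Pi . \end{aligned}$$ The inner linear programs $\max_{\mathbf u\in\mathcal U(\mathbf x)}(-\mathbf E\mathbf u)^\intercal\boldsymbol\beta$ attain their maxima for all $\mathbf x\in\mathcal X$ and all $\boldsymbol\beta$. Here two formulations are equivalent if they have the same optimal value and the same optimal first-stage solutions, i.e. $\mathbf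 x$ is part of an optimal (feasible and minimizing) solution of one if and only if it is part of an optimal solution of the other. -/

import Mathlib

open Matrix

/-- A minimization formulation in a first-stage variable of type `V` and an auxiliary variable of
type `Z`. -/
structure MinProgram (V Z : Type*) where
  /-- the set of feasible solutions -/
  feasible : Set (V × Z)
  /-- the objective function, with values in `[-∞, +∞]` -/
  objective : V × Z → EReal

namespace MinProgram

variable {V Z W : Type*}

/-- The optimal value; it is `+∞` for an infeasible program. -/
noncomputable def optValue (P : MinProgram V Z) : EReal :=
  ⨅ p ∈ P.feasible, P.objective p

/-- Optimal solutions: feasible solutions at which the minimum is attained. -/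
def IsOptimal (P : MinProgram V Z) (p : V × Z) : Prop :=
  p ∈ P.feasible ∧ ∀ q ∈ P.feasible, P.objective p ≤ P.objective q

/-- `x` is the first-stage part of an optimal solution. -/
def IsOptimalFirstStage (P : MinProgram V Z) (x : V) : Prop :=
  ∃ z, P.IsOptimal (x, z)

/-- Two formulations are equivalent if they share the same optimal value and the same optimal
first-stage solutions. -/
def Equivalent (P : MinProgram V Z) (Q : MinProgram V W) : Prop :=
  P.optValue = Q.optValue ∧ ∀ x, P.IsOptimalFirstStage x ↔ Q.IsOptimalFirstStage x

end MinProgram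

section Polyhedra

variable {V : Type*} [AddCommGroup V] [Module ℝ V]

/-- The recession cone of a set. -/
def recessionCone (S : Set V) : Set V :=
  {γ | ∀ p ∈ S, ∀ t : ℝ, 0 ≤ t → p + t • γ ∈ S}

/-- `γ` generates an extreme ray of `S`: it is a nonzero element of the recession cone that is not
the sum of two elements of the recession cone unless these lie on the ray generated by `γ`. -/
def GeneratesExtremeRay (S : Set V) (γ : V) : Prop :=
  γ ∈ recessionCone S ∧ γ ≠ 0 ∧
    ∀ a ∈ recessionCone S, ∀ b ∈ recessionCone S, a + b = γ → ∃ t : ℝ, 0 ≤ t ∧ a = t • γ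

/-- `R` is the set of extreme rays of `S`, each of them given by one generator: `R` consists of
generators of extreme rays, and every extreme ray has exactly one generator in `R`. -/
def IsExtremeRaySet (S R : Set V) : Prop :=
  (∀ γ ∈ R, GeneratesExtremeRay S γ) ∧
    ∀ γ, GeneratesExtremeRay S γ → ∃! ρ, ρ ∈ R ∧ ∃ t : ℝ, 0 < t ∧ γ = t • ρ

end Polyhedra

/-- The data of a two-stage robust optimization problem with decision-dependent uncertainty:
`mx` integer and `nx` continuous first-stage variables, `nu` continuous uncertainty variables,
`ny` continuous recourse variables, and `kx`, `ku`, `ky` linear constraints in the first stage, in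
the uncertainty set and in the recourse problem. -/
structure TwoStageRO (mx nx nu ny kx ku ky : ℕ) where
  c₁ : Fin mx ⊕ Fin nx → ℝ
  A : Matrix (Fin kx) (Fin mx ⊕ Fin nx) ℝ
  b : Fin kx → ℝ
  F : (Fin mx ⊕ Fin nx → ℝ) → Matrix (Fin ku) (Fin nu) ℝ
  h : Fin ku → ℝ
  G : Matrix (Fin ku) (Fin mx ⊕ Fin nx) ℝ
  c₂ : Fin ny → ℝ
  B₁ : Matrix (Fin ky) (Fin mx ⊕ Fin nx) ℝ
  B₂ : Matrix (Fin ky) (Fin ny) ℝ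
  E : Matrix (Fin ky) (Fin nu) ℝ
  d : Fin ky → ℝ

namespace TwoStageRO

variable {mx nx nu ny kx ku ky : ℕ} (D : TwoStageRO mx nx nu ny kx ku ky)

/-- The first-stage set `𝒳 = {x ∈ ℤ₊^mx × ℝ₊^nx : A x ≥ b}`. -/
def firstStage : Set (Fin mx ⊕ Fin nx → ℝ) :=
  {x | (∀ i, ∃ k : ℕ, x (Sum.inl i) = k) ∧ (∀ j, 0 ≤ x (Sum.inr j)) ∧ D.b ≤ D.A *ᵥ x}

/-- The uncertainty set `𝒰(x) = {u ∈ ℝ₊^nu : F(x) u ≤ h + G x}`. -/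
def uncertainty (x : Fin mx ⊕ Fin nx → ℝ) : Set (Fin nu → ℝ) :=
  {u | 0 ≤ u ∧ D.F x *ᵥ u ≤ D.h + D.G *ᵥ x}

/-- The recourse set `𝒴(x, u) = {y ∈ ℝ₊^ny : B₂ y ≥ d - B₁ x - E u}`. -/
def recourse (x : Fin mx ⊕ Fin nx → ℝ) (u : Fin nu → ℝ) : Set (Fin ny → ℝ) :=
  {y | 0 ≤ y ∧ D.d - D.B₁ *ᵥ x - D.E *ᵥ u ≤ D.B₂ *ᵥ y}

/-- The optimal value of the recourse problem, `+∞` if that problem is infeasible. -/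
noncomputable def recourseValue (x : Fin mx ⊕ Fin nx → ℝ) (u : Fin nu → ℝ) : EReal :=
  ⨅ y ∈ D.recourse x u, ((D.c₂ ⬝ᵥ y : ℝ) : EReal)

/-- The feasible set `Π = {π ≥ 0 : B₂ᵀ π ≤ c₂ᵀ}` of the dual of the recourse problem. -/
def dualPolyhedron : Set (Fin ky → ℝ) :=
  {π | 0 ≤ π ∧ D.B₂ᵀ *ᵥ π ≤ D.c₂}

/-- The problem `min_{x ∈ 𝒳} c₁ x + max_{u ∈ 𝒰(x)} min_{y ∈ 𝒴(x, u)} c₂ y`. A first-stage decision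
is feasible if the recourse problem is feasible for every `u ∈ 𝒰(x)`. -/
noncomputable def twoStage : MinProgram (Fin mx ⊕ Fin nx → ℝ) Unit where
  feasible := {p | p.1 ∈ D.firstStage ∧ ∀ u ∈ D.uncertainty p.1, (D.recourse p.1 u).Nonempty}
  objective p := ((D.c₁ ⬝ᵥ p.1 : ℝ) : EReal) + ⨆ u ∈ D.uncertainty p.1, D.recourseValue p.1 u

/-- The optimal value of the disjoint bilinear program
`max {(d - B₁ x - E u)ᵀ π : u ∈ 𝒰(x), π ∈ Π}`. -/
noncomputable def bilinearValue (x : Fin mx ⊕ Fin nx → ℝ) : EReal :=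
  ⨆ u ∈ D.uncertainty x, ⨆ π ∈ D.dualPolyhedron,
    (((D.d - D.B₁ *ᵥ x - D.E *ᵥ u) ⬝ᵥ π : ℝ) : EReal)

/-- The bilevel problem
`min_{x ∈ 𝒳} c₁ x + max {(d - B₁ x - E u)ᵀ π : u ∈ 𝒰(x), π ∈ Π}`. A first-stage decision is
feasible if its lower-level maximization problem is not unbounded. -/
noncomputable def bilinearBilevel : MinProgram (Fin mx ⊕ Fin nx → ℝ) Unit where
  feasible := {p | p.1 ∈ D.firstStage ∧ D.bilinearValue p.1 ≠ ⊤}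
  objective p := ((D.c₁ ⬝ᵥ p.1 : ℝ) : EReal) + D.bilinearValue p.1

/-- The optimal value of the linear program `max {(-E u)ᵀ β : u ∈ 𝒰(x)}`. -/
noncomputable def innerLP (x : Fin mx ⊕ Fin nx → ℝ) (β : Fin ky → ℝ) : EReal :=
  ⨆ u ∈ D.uncertainty x, (((-(D.E *ᵥ u)) ⬝ᵥ β : ℝ) : EReal)

/-- The bilevel linear program in `(x, η)` that minimizes `c₁ x + η` over `x ∈ 𝒳` subject to one
optimality constraint for each member of `P` and one feasibility constraint for each member
of `R`. -/
noncomputable def enumeration (P R : Set (Fin ky → ℝ)) :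
    MinProgram (Fin mx ⊕ Fin nx → ℝ) ℝ where
  feasible := {p | p.1 ∈ D.firstStage ∧
    (∀ π ∈ P, (((D.d - D.B₁ *ᵥ p.1) ⬝ᵥ π : ℝ) : EReal) + D.innerLP p.1 π ≤ (p.2 : EReal)) ∧
    ∀ γ ∈ R, (((D.d - D.B₁ *ᵥ p.1) ⬝ᵥ γ : ℝ) : EReal) + D.innerLP p.1 γ ≤ 0}
  objective p := ((D.c₁ ⬝ᵥ p.1 + p.2 : ℝ) : EReal)

/-- The mixed integer program `min {c₁ x + c₂ y : x ∈ 𝒳, u ∈ 𝒰(x), y ∈ 𝒴(x, u)}`. -/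
noncomputable def relaxation :
    MinProgram (Fin mx ⊕ Fin nx → ℝ) ((Fin nu → ℝ) × (Fin ny → ℝ)) where
  feasible := {p | p.1 ∈ D.firstStage ∧ p.2.1 ∈ D.uncertainty p.1 ∧
    p.2.2 ∈ D.recourse p.1 p.2.1}
  objective p := ((D.c₁ ⬝ᵥ p.1 + D.c₂ ⬝ᵥ p.2.2 : ℝ) : EReal)

end TwoStageRO

/-! Fix `x` and `u` and put `w = d - B₁ x - E u`. A finite relaxation value forces `Π` to be
nonempty: some recourse problem is feasible and bounded below, so its dual is feasible. Hence
whenever the recourse problem is feasible, its value is the supremum of `w ⬝ᵥ π` over `Π`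
(`exists_dual_gt`). By Farkas' lemma (`farkas_finset`), feasibility means that `w` is nonpositive on
the recession cone of `Π`.

As `Π` lies in the nonnegative orthant, it is pointed. So nonpositivity on the cone need only be
tested on extreme rays, and a functional passing that test is dominated on `Π` by its values at
extreme points (`exists_extremePoint_ge`). Exchanging the quantifiers over `u` and `π` turns these
tests into the constraints of the enumeration: they describe the epigraph of `bilinearValue`
(`constraints_iff_bilinearValue_le`). There are finitely many extreme points and `𝒰(x)` is compact,
so every feasible `x` admits a real `η`, and `MinProgram.equivalent_epigraph` concludes. -/

section LinearInequalities

/-! ### Farkas' lemma and extreme points of pointed polyhedra. -/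

variable {E ι : Type*} [AddCommGroup E] [Module ℝ E]

/-- **Farkas' lemma** for finitely many linear functionals. -/
theorem farkas_finset (s : Finset ι) (a : ι → E →ₗ[ℝ] ℝ) (b : E →ₗ[ℝ] ℝ)
    (h : ∀ x, (∀ i ∈ s, a i x ≤ 0) → b x ≤ 0) :
    ∃ c : ι → ℝ, (∀ i, 0 ≤ c i) ∧ b = ∑ i ∈ s, c i • a i := by
  classical
  induction s using Finset.induction_on generalizing a b with
  | empty =>
    refine ⟨0, fun _ => le_rfl, LinearMap.ext fun x => ?_⟩
    have h₁ := h x (by simp)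
    have h₂ := h (-x) (by simp)
    rw [map_neg] at h₂
    simp only [Finset.sum_empty, LinearMap.zero_apply]
    linarith
  | insert j s hj ih =>
    by_cases hs : ∀ x, (∀ i ∈ s, a i x ≤ 0) → b x ≤ 0
    · obtain ⟨c, hc, hb⟩ := ih a b hs
      refine ⟨Function.update c j 0, fun i => ?_, ?_⟩
      · by_cases hi : i = j
        · subst hi; simp
        · simp [hi, hc i]
      · rw [Finset.sum_insert hj, Function.update_self, zero_smul, zero_add, hb]
        refine Finset.sum_congr rfl fun i hi => ?_
        rw [Function.update_of_ne (ne_of_mem_of_not_mem hi hj)]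
    · push Not at hs
      obtain ⟨y, hy, hby⟩ := hs
      have hjy : 0 < a j y := by
        by_contra! hneg
        exact absurd (h y (by simpa [Finset.forall_mem_insert] using ⟨hneg, hy⟩)) (not_le.2 hby)
      -- These are the functionals composed with the projection `x ↦ x - (a j x / a j y) • y` onto
      -- the kernel of `a j`, where the constraint `j` holds trivially.
      obtain ⟨c, hc, hb⟩ := ih (fun i => a i - (a i y / a j y) • a j)
        (b - (b y / a j y) • a j) (fun x hx => by
          have key := h (x - (a j x / a j y) • y) (fun i hi => by
            rcases Finset.mem_insert.1 hi with rfl | hi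
            · simp [hjy.ne']
            · have := hx i hi
              simp only [LinearMap.sub_apply, LinearMap.smul_apply, smul_eq_mul, map_sub,
                map_smul] at this ⊢
              convert this using 2
              ring)
          simp only [LinearMap.sub_apply, LinearMap.smul_apply, smul_eq_mul, map_sub,
            map_smul] at key ⊢
          convert key using 2
          ring)
      -- The coefficient of `a j` once the projected identity is expanded; the signs of `b y`, `a j
      -- y` and `a i y` make it nonnegative.
      set r : ℝ := b y / a j y - ∑ i ∈ s, c i * (a i y / a j y) with hr
      have hr0 : 0 ≤ r := by
        have h₁ : 0 ≤ b y / a j y := by positivity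
        have h₂ : ∑ i ∈ s, c i * (a i y / a j y) ≤ 0 := Finset.sum_nonpos fun i hi =>
          mul_nonpos_of_nonneg_of_nonpos (hc i) (div_nonpos_of_nonpos_of_nonneg (hy i hi) hjy.le)
        linarith
      refine ⟨Function.update c j r, fun i => ?_, ?_⟩
      · by_cases hi : i = j
        · subst hi; simpa using hr0
        · simp [hi, hc i]
      · rw [Finset.sum_insert hj, Function.update_self]
        have hcongr : ∑ i ∈ s, Function.update c j r i • a i = ∑ i ∈ s, c i • a i :=
          Finset.sum_congr rfl fun i hi => by
            rw [Function.update_of_ne (ne_of_mem_of_not_mem hi hj)]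
        rw [hcongr]
        refine LinearMap.ext fun x => ?_
        have hbx := LinearMap.congr_fun hb x
        simp only [LinearMap.sub_apply, LinearMap.add_apply, LinearMap.smul_apply, smul_eq_mul,
          LinearMap.sum_apply, mul_sub, Finset.sum_sub_distrib, ← mul_assoc,
          ← Finset.sum_mul] at hbx ⊢
        rw [hr, sub_mul]
        linarith

variable (a : ι → E →ₗ[ℝ] ℝ) (q : ι → ℝ)

/-- A feasible point of a system of linear inequalities can be moved along a direction that
keeps the tight inequalities tight, until a further inequality becomes tight. -/
theorem exists_move_to_tight [Finite ι] {x δ : E} (hx : ∀ i, a i x ≤ q i)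
    (hδ : ∀ i, a i x = q i → a i δ = 0) (hpos : ∃ i, 0 < a i δ) :
    ∃ t : ℝ, 0 ≤ t ∧ (∀ i, a i (x + t • δ) ≤ q i) ∧
      {i | a i (x + t • δ) ≠ q i} ⊂ {i | a i x ≠ q i} := by
  classical
  cases nonempty_fintype ι
  obtain ⟨i₀, hi₀⟩ := hpos
  -- Ratio test: `j` is an inequality that becomes tight first along `δ`.
  obtain ⟨j, hj, hmin⟩ := Finset.exists_min_image (Finset.univ.filter fun i => 0 < a i δ)
    (fun i => (q i - a i x) / a i δ) ⟨i₀, by simpa using hi₀⟩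
  have hj : 0 < a j δ := by simpa using hj
  refine ⟨(q j - a j x) / a j δ, div_nonneg (sub_nonneg.2 (hx j)) hj.le, fun i => ?_, ?_⟩
  · simp only [map_add, map_smul, smul_eq_mul]
    have ht : 0 ≤ (q j - a j x) / a j δ := div_nonneg (sub_nonneg.2 (hx j)) hj.le
    rcases le_or_gt (a i δ) 0 with hi | hi
    · have := mul_nonpos_of_nonneg_of_nonpos ht hi
      linarith [hx i]
    · have := hmin i (by simpa using hi)
      rw [le_div_iff₀ hi] at this
      linarith
  · rw [Set.ssubset_iff_of_subset]
    · refine ⟨j, fun htight => hj.ne' (hδ j htight), ?_⟩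
      simp [hj.ne']
    · intro i hi htight
      refine hi ?_
      simp [hδ i htight, htight]

/-- If a linear functional is bounded above on the recession cone of a pointed polyhedron, then its
value at any point of the polyhedron is dominated by its value at some extreme point. -/
theorem exists_extremePoint_ge [Finite ι] (hker : ∀ δ, (∀ i, a i δ = 0) → δ = 0)
    (w : E →ₗ[ℝ] ℝ) (hw : ∀ δ, (∀ i, a i δ ≤ 0) → w δ ≤ 0) (x : E) (hx : ∀ i, a i x ≤ q i) :
    ∃ p ∈ {x | ∀ i, a i x ≤ q i}.extremePoints ℝ, w x ≤ w p := by
  -- Induction on the number of slack inequalities: a point that is not extreme can be moved,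
  -- without decreasing `w`, until one more is tight.
  induction hn : {i | a i x ≠ q i}.ncard using Nat.strong_induction_on generalizing x with
  | _ n ih =>
  subst hn
  by_cases hext : x ∈ {x | ∀ i, a i x ≤ q i}.extremePoints ℝ
  · exact ⟨x, hext, le_rfl⟩
  -- An inequality tight inside a segment of feasible points is tight at both ends, so the
  -- difference of the ends serves as direction.
  obtain ⟨δ, hδ0, hδ⟩ : ∃ δ : E, δ ≠ 0 ∧ ∀ i, a i x = q i → a i δ = 0 := by
    rw [mem_extremePoints] at hext
    push Not at hext
    obtain ⟨y, hy, z, hz, hxyz, hne⟩ := hext hx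
    refine ⟨y - z, fun h0 => ?_, fun i hi => ?_⟩
    · have hyz : y = z := sub_eq_zero.1 h0
      subst hyz
      rw [openSegment_same, Set.mem_singleton_iff] at hxyz
      exact hne hxyz.symm hxyz.symm
    · obtain ⟨s, t, hs, ht, hst, rfl⟩ := hxyz
      simp only [map_add, map_smul, smul_eq_mul, map_sub] at hi ⊢
      have hy := hy i
      have hz := hz i
      have h₁ : s * (q i - a i y) + t * (q i - a i z) = 0 := by
        linear_combination (q i) * hst - hi
      have h₂ := mul_nonneg hs.le (sub_nonneg.2 hy)
      have h₃ := mul_nonneg ht.le (sub_nonneg.2 hz)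
      have h₄ : s * (q i - a i y) = 0 := by linarith
      have h₅ : t * (q i - a i z) = 0 := by linarith
      have h₆ := (mul_eq_zero.1 h₄).resolve_left hs.ne'
      have h₇ := (mul_eq_zero.1 h₅).resolve_left ht.ne'
      linarith
  -- Orient `δ` so that `w` does not decrease. If no inequality stops the motion, `δ` is a recession
  -- direction, so `w δ ≤ 0` and `-δ` works; pointedness ensures that it is stopped.
  obtain ⟨δ', hδ', hwδ', hpos⟩ : ∃ δ' : E, (∀ i, a i x = q i → a i δ' = 0) ∧ 0 ≤ w δ' ∧
      ∃ i, 0 < a i δ' := by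
    wlog hwδ : 0 ≤ w δ generalizing δ
    · exact this (-δ) (neg_ne_zero.2 hδ0) (fun i hi => by simp [hδ i hi])
        (by rw [map_neg]; linarith)
    by_cases hpos : ∃ i, 0 < a i δ
    · exact ⟨δ, hδ, hwδ, hpos⟩
    · push Not at hpos
      refine ⟨-δ, fun i hi => by simp [hδ i hi], by simpa using hw δ hpos, ?_⟩
      by_contra! hneg
      refine hδ0 (hker δ fun i => le_antisymm (hpos i) ?_)
      simpa using hneg i
  obtain ⟨t, ht, hfeas, hlt⟩ := exists_move_to_tight a q hx hδ' hpos
  obtain ⟨p, hp, hle⟩ := ih _ (Set.ncard_lt_ncard hlt) _ hfeas rfl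
  refine ⟨p, hp, le_trans ?_ hle⟩
  simp only [map_add, map_smul, smul_eq_mul]
  have := mul_nonneg ht hwδ'
  linarith

/-- A polyhedron has finitely many extreme points. -/
theorem finite_extremePoints [Finite ι] : ({x | ∀ i, a i x ≤ q i}.extremePoints ℝ).Finite := by
  -- An extreme point is determined by its tight set: if `p'` is tight wherever `p` is, the segment
  -- from `p'` to `p` extends slightly beyond `p`.
  refine Set.Finite.of_injOn (f := fun x => {i | a i x = q i}) (t := Set.univ)
    (fun _ _ => Set.mem_univ _) ?_ Set.finite_univ
  intro p hp p' hp' htight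
  have htight : ∀ i, a i p = q i → a i p' = q i := fun i hi =>
    (Set.ext_iff.1 htight i).1 hi
  have hev : ∀ᶠ ε : ℝ in nhdsWithin 0 (Set.Ioi 0), ∀ i, a i (p + ε • (p - p')) ≤ q i := by
    rw [Filter.eventually_all]
    intro i
    have hle : a i p ≤ q i := hp.1 i
    rcases hle.eq_or_lt with hi | hi
    · refine Filter.Eventually.of_forall fun ε => ?_
      simp [hi, htight i hi]
    · refine Filter.Eventually.filter_mono nhdsWithin_le_nhds ?_
      have hcont : Continuous fun ε : ℝ => a i (p + ε • (p - p')) := by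
        simp only [map_add, map_smul, smul_eq_mul]
        fun_prop
      have : a i (p + (0 : ℝ) • (p - p')) < q i := by simpa using hi
      exact ((hcont.tendsto 0).eventually_lt_const this).mono fun _ h => h.le
  obtain ⟨ε, hε, hε0⟩ := (hev.and self_mem_nhdsWithin).exists
  have hε0 : 0 < ε := hε0
  have hseg : p ∈ openSegment ℝ p' (p + ε • (p - p')) := by
    refine ⟨ε / (1 + ε), 1 / (1 + ε), by positivity, by positivity, by field_simp; ring, ?_⟩
    have h1 : (1 + ε) ≠ 0 := by positivity
    have : p = ((1 + ε)⁻¹ * (1 + ε)) • p := by rw [inv_mul_cancel₀ h1, one_smul]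
    rw [div_eq_mul_inv, div_eq_mul_inv]
    conv_rhs => rw [this]
    module
  exact ((mem_extremePoints.1 hp).2 p' hp'.1 _ hε hseg).1.symm

/-- The recession cone of a nonempty polyhedron. -/
theorem recessionCone_eq (hne : {x | ∀ i, a i x ≤ q i}.Nonempty) :
    recessionCone {x | ∀ i, a i x ≤ q i} = {γ | ∀ i, a i γ ≤ 0} := by
  ext γ
  constructor
  · intro hγ i
    obtain ⟨p, hp⟩ := hne
    by_contra! hpos
    -- This step length makes the value of `a i` equal to `q i + 1`.
    have h := hγ p hp ((q i - a i p + 1) / a i γ)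
      (div_nonneg (by linarith [hp i]) hpos.le) i
    simp only [map_add, map_smul, smul_eq_mul, div_mul_cancel₀ _ hpos.ne'] at h
    linarith
  · intro hγ p hp t ht i
    simp only [map_add, map_smul, smul_eq_mul]
    have := mul_nonpos_of_nonneg_of_nonpos ht (hγ i)
    linarith [hp i]

/-! ### Extreme rays as extreme points of a base of the recession cone. -/

variable (σ : E →ₗ[ℝ] ℝ)

/-- The base `{γ ∈ C | σ γ = 1}` of the cone `C` of all `γ` with `a i γ ≤ 0`. -/
def coneBase : Set E := {γ | (∀ i, a i γ ≤ 0) ∧ σ γ = 1}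

/-- Splitting `σ γ = 1` into two inequalities makes the base a polyhedron in the form required by
the extreme point results. -/
theorem coneBase_eq : coneBase a σ =
    {γ | ∀ i, Sum.elim a ![σ, -σ] i γ ≤ Sum.elim (0 : ι → ℝ) ![1, -1] i} := by
  ext γ
  simp [coneBase, Sum.forall, Fin.forall_fin_two, le_antisymm_iff]

variable {a σ} {q} (hσ : ∀ γ, (∀ i, a i γ ≤ 0) → γ ≠ 0 → 0 < σ γ)
include hσ

/-- Extreme points of a base of the recession cone generate extreme rays. -/
theorem generatesExtremeRay_of_mem_extremePoints_coneBase
    (hne : {x | ∀ i, a i x ≤ q i}.Nonempty) {γ : E} (hγ : γ ∈ (coneBase a σ).extremePoints ℝ) :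
    GeneratesExtremeRay {x | ∀ i, a i x ≤ q i} γ := by
  rw [GeneratesExtremeRay, recessionCone_eq a q hne]
  refine ⟨hγ.1.1, fun h0 => ?_, fun x hx y hy hxy => ?_⟩
  · have := hγ.1.2
    simp [h0] at this
  · by_cases hx0 : x = 0
    · exact ⟨0, le_rfl, by simp [hx0]⟩
    by_cases hy0 : y = 0
    · exact ⟨1, zero_le_one, by simp [← hxy, hy0]⟩
    have hσx := hσ x hx hx0
    have hσy := hσ y hy hy0
    have hsum : σ x + σ y = 1 := by rw [← map_add, hxy]; exact hγ.1.2
    have hmem : ∀ z, (∀ i, a i z ≤ 0) → 0 < σ z → (σ z)⁻¹ • z ∈ coneBase a σ := by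
      refine fun z hz hσz => ⟨fun i => ?_, by simp [hσz.ne']⟩
      rw [map_smul, smul_eq_mul]
      exact mul_nonpos_of_nonneg_of_nonpos (inv_nonneg.2 hσz.le) (hz i)
    -- Rescaled to the base, `x` and `y` have `γ` as convex combination with weights `σ x` and `σ
    -- y`.
    have := ((mem_extremePoints.1 hγ).2 _ (hmem x hx hσx) _ (hmem y hy hσy)
      ⟨σ x, σ y, hσx, hσy, hsum, by simp [smul_smul, hσx.ne', hσy.ne', hxy]⟩).1
    exact ⟨σ x, hσx.le, by rw [← this, smul_smul, mul_inv_cancel₀ hσx.ne', one_smul]⟩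

/-- The point at which an extreme ray meets a base of the recession cone is an extreme point of
that base. -/
theorem mem_extremePoints_coneBase_of_generatesExtremeRay
    (hne : {x | ∀ i, a i x ≤ q i}.Nonempty) {γ : E}
    (hγ : GeneratesExtremeRay {x | ∀ i, a i x ≤ q i} γ) :
    (σ γ)⁻¹ • γ ∈ (coneBase a σ).extremePoints ℝ := by
  rw [GeneratesExtremeRay, recessionCone_eq a q hne] at hγ
  obtain ⟨hγC, hγ0, hγ⟩ := hγ
  have hσγ := hσ γ hγC hγ0
  have hscale : ∀ (t : ℝ) z, 0 ≤ t → (∀ i, a i z ≤ 0) → ∀ i, a i (t • z) ≤ 0 := by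
    intro t z ht hz i
    rw [map_smul, smul_eq_mul]
    exact mul_nonpos_of_nonneg_of_nonpos ht (hz i)
  have key : ∀ x ∈ coneBase a σ, ∀ y ∈ coneBase a σ, ∀ s t : ℝ, 0 < s → 0 < t →
      s • x + t • y = (σ γ)⁻¹ • γ → x = (σ γ)⁻¹ • γ := by
    intro x hx y hy s t hs ht hst
    -- Multiplying by `σ γ` gives a decomposition of `γ` itself; then `σ x = 1` determines the
    -- multiple `r`.
    obtain ⟨r, -, hr⟩ := hγ ((σ γ * s) • x) (hscale _ _ (by positivity) hx.1)
      ((σ γ * t) • y) (hscale _ _ (by positivity) hy.1) (by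
        rw [mul_smul, mul_smul, ← smul_add, hst, smul_smul, mul_inv_cancel₀ hσγ.ne', one_smul])
    have hr' := congrArg σ hr
    rw [map_smul, map_smul, hx.2, smul_eq_mul, smul_eq_mul, mul_one] at hr'
    have hrs : r = s := by
      have := mul_left_cancel₀ hσγ.ne' (hr'.trans (mul_comm r _))
      exact this.symm
    subst hrs
    rw [← inv_smul_smul₀ (mul_pos hσγ hs).ne' x, hr, smul_smul]
    congr 1
    field_simp
  refine mem_extremePoints.2 ⟨⟨hscale _ _ (inv_nonneg.2 hσγ.le) hγC, by simp [hσγ.ne']⟩, ?_⟩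
  rintro x hx y hy ⟨s, t, hs, ht, -, hst⟩
  exact ⟨key x hx y hy s t hs ht hst, key y hy x hx t s ht hs (by rw [add_comm, hst])⟩

/-- A pointed polyhedron has finitely many extreme rays. -/
theorem IsExtremeRaySet.finite [Finite ι] (hne : {x | ∀ i, a i x ≤ q i}.Nonempty) {R : Set E}
    (hR : IsExtremeRaySet {x | ∀ i, a i x ≤ q i} R) : R.Finite := by
  have hfin : ((coneBase a σ).extremePoints ℝ).Finite := by
    rw [coneBase_eq]
    exact finite_extremePoints _ _
  refine Set.Finite.of_injOn (f := fun γ => (σ γ)⁻¹ • γ)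
    (fun γ hγ => mem_extremePoints_coneBase_of_generatesExtremeRay hσ hne (hR.1 γ hγ)) ?_ hfin
  have hpos : ∀ γ ∈ R, 0 < σ γ := fun γ hγ => by
    have h := hR.1 γ hγ
    rw [GeneratesExtremeRay, recessionCone_eq a q hne] at h
    exact hσ γ h.1 h.2.1
  intro γ hγ ρ hρ (hγρ : (σ γ)⁻¹ • γ = (σ ρ)⁻¹ • ρ)
  have hγσ := hpos γ hγ
  have hρσ := hpos ρ hρ
  refine (hR.2 γ (hR.1 γ hγ)).unique ⟨hγ, 1, one_pos, (one_smul _ _).symm⟩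
    ⟨hρ, σ γ * (σ ρ)⁻¹, by positivity, ?_⟩
  rw [mul_smul, ← hγρ, smul_smul, mul_inv_cancel₀ hγσ.ne', one_smul]

/-- A linear functional that is nonpositive on the extreme rays of a pointed polyhedron is
nonpositive on its recession cone. -/
theorem IsExtremeRaySet.nonpos_of_forall_nonpos [Finite ι]
    (hne : {x | ∀ i, a i x ≤ q i}.Nonempty) {R : Set E}
    (hR : IsExtremeRaySet {x | ∀ i, a i x ≤ q i} R) (w : E →ₗ[ℝ] ℝ) (hw : ∀ γ ∈ R, w γ ≤ 0)
    {γ : E} (hγ : ∀ i, a i γ ≤ 0) : w γ ≤ 0 := by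
  by_cases hγ0 : γ = 0
  · simp [hγ0]
  have hσγ := hσ γ hγ hγ0
  -- The base has no nonzero recession direction, which settles both hypotheses of
  -- `exists_extremePoint_ge`, for any `w`.
  have hzero : ∀ δ, (∀ i, Sum.elim a ![σ, -σ] i δ ≤ 0) → δ = 0 := by
    intro δ hδ
    by_contra hδ0
    have h₁ : σ δ ≤ 0 := by simpa using hδ (Sum.inr 0)
    exact absurd (hσ δ (fun i => hδ (Sum.inl i)) hδ0) (not_lt.2 h₁)
  obtain ⟨p, hp, hle⟩ := exists_extremePoint_ge (Sum.elim a ![σ, -σ])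
    (Sum.elim (0 : ι → ℝ) ![1, -1]) (fun δ hδ => hzero δ fun i => (hδ i).le) w
    (fun δ hδ => by simp [hzero δ hδ]) ((σ γ)⁻¹ • γ) (by
      have : (σ γ)⁻¹ • γ ∈ coneBase a σ := by
        refine ⟨fun i => ?_, by simp [hσγ.ne']⟩
        rw [map_smul, smul_eq_mul]
        exact mul_nonpos_of_nonneg_of_nonpos (inv_nonneg.2 hσγ.le) (hγ i)
      rwa [coneBase_eq] at this)
  rw [← coneBase_eq] at hp
  obtain ⟨ρ, ⟨hρ, t, ht, rfl⟩, -⟩ :=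
    hR.2 p (generatesExtremeRay_of_mem_extremePoints_coneBase hσ hne hp)
  rw [map_smul, map_smul, smul_eq_mul, smul_eq_mul] at hle
  have h₁ := mul_nonpos_of_nonneg_of_nonpos ht.le (hw ρ hρ)
  by_contra! hpos
  have := mul_pos (inv_pos.2 hσγ) hpos
  linarith

end LinearInequalities

/-! ### Linear programming duality in matrix form. -/

section MatrixInequalities

variable {m n : Type*} [Fintype m]

/-- The functionals on the left-hand sides of the system `Aᵀ π ≤ c, -π ≤ 0`. -/
def dualFunctional (A : Matrix m n ℝ) : n ⊕ m → (m → ℝ) →ₗ[ℝ] ℝ :=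
  Sum.elim (fun j => LinearMap.proj j ∘ₗ Aᵀ.mulVecLin) (fun i => -LinearMap.proj i)

theorem forall_dualFunctional_le (A : Matrix m n ℝ) (c : n → ℝ) (π : m → ℝ) :
    (∀ i, dualFunctional A i π ≤ Sum.elim c 0 i) ↔ 0 ≤ π ∧ Aᵀ *ᵥ π ≤ c := by
  simp [dualFunctional, Sum.forall, Pi.le_def, and_comm, mulVec_transpose]

theorem forall_dualFunctional_nonpos (A : Matrix m n ℝ) (π : m → ℝ) :
    (∀ i, dualFunctional A i π ≤ 0) ↔ 0 ≤ π ∧ Aᵀ *ᵥ π ≤ 0 := by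
  simp [dualFunctional, Sum.forall, Pi.le_def, and_comm, mulVec_transpose]

variable [Fintype n]

/-- **Farkas' lemma** for the system `y ≥ 0, A y ≥ w`. -/
theorem exists_nonneg_le_mulVec (A : Matrix m n ℝ) (w : m → ℝ)
    (h : ∀ γ, 0 ≤ γ → Aᵀ *ᵥ γ ≤ 0 → w ⬝ᵥ γ ≤ 0) : ∃ y, 0 ≤ y ∧ w ≤ A *ᵥ y := by
  classical
  obtain ⟨c, hc, hw⟩ := farkas_finset Finset.univ (dualFunctional A) (dotProductEquiv ℝ m w)
    (fun γ hγ => by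
      have := (forall_dualFunctional_nonpos A γ).1 fun i => hγ i (Finset.mem_univ i)
      simpa using h γ this.1 this.2)
  -- The multipliers of the rows of `Aᵀ` form `y`; those of the sign constraints are the slacks of
  -- `w ≤ A *ᵥ y`.
  refine ⟨fun j => c (Sum.inl j), fun j => hc _, fun i => ?_⟩
  have hi := LinearMap.congr_fun hw (Pi.single i 1)
  have h₁ : (A *ᵥ fun j => c (Sum.inl j)) i = ∑ j, c (Sum.inl j) * A i j := by
    simp [mulVec, dotProduct, mul_comm]
  have h₂ : ∑ j, c (Sum.inr j) * (Pi.single i (1 : ℝ) : m → ℝ) j = c (Sum.inr i) := by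
    simp [Pi.single_apply]
  simp only [dotProductEquiv_apply_apply, dotProduct_single, mul_one, Fintype.sum_sum_type,
    dualFunctional, LinearMap.add_apply, LinearMap.sum_apply, LinearMap.smul_apply, Sum.elim_inl,
    Sum.elim_inr, LinearMap.comp_apply, LinearMap.neg_apply, LinearMap.proj_apply, smul_eq_mul,
    mulVecLin_apply, mulVec_single_one, mul_neg, Finset.sum_neg_distrib, h₂] at hi
  rw [h₁, hi]
  have : ∑ j, c (Sum.inl j) * (Aᵀ.col i) j = ∑ j, c (Sum.inl j) * A i j := rfl
  linarith [hc (Sum.inr i)]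

/-- Weak duality. -/
theorem dotProduct_le_dotProduct_of_dual {A : Matrix m n ℝ} {w π : m → ℝ} {c y : n → ℝ}
    (hy : 0 ≤ y) (hwy : w ≤ A *ᵥ y) (hπ : 0 ≤ π) (hπc : Aᵀ *ᵥ π ≤ c) : w ⬝ᵥ π ≤ c ⬝ᵥ y :=
  calc w ⬝ᵥ π ≤ (A *ᵥ y) ⬝ᵥ π := dotProduct_le_dotProduct_of_nonneg_right hwy hπ
    _ = (Aᵀ *ᵥ π) ⬝ᵥ y := by rw [dotProduct_comm, dotProduct_mulVec, mulVec_transpose]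
    _ ≤ c ⬝ᵥ y := dotProduct_le_dotProduct_of_nonneg_right hπc hy

/-- Strong duality: a strict lower bound of a feasible linear program is exceeded by the value of
a dual feasible solution. -/
theorem exists_dual_gt {A : Matrix m n ℝ} {w : m → ℝ} {c : n → ℝ} {z : ℝ}
    (hne : ∃ y, 0 ≤ y ∧ w ≤ A *ᵥ y) (hz : ∀ y, 0 ≤ y → w ≤ A *ᵥ y → z < c ⬝ᵥ y) :
    ∃ π, 0 ≤ π ∧ Aᵀ *ᵥ π ≤ c ∧ z < w ⬝ᵥ π := by
  by_contra! hcon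
  -- Farkas for `A y ≥ w` augmented by the row `-c y ≥ -z`; a solution would contradict `hz`.
  obtain ⟨y, hy, hwy⟩ := exists_nonneg_le_mulVec
    (Matrix.of (Sum.elim A fun _ : Unit => -c)) (Sum.elim w fun _ => -z) (by
      intro γ hγ hγA
      have hγA : ∀ j, ∑ i, A i j * γ (Sum.inl i) ≤ c j * γ (Sum.inr ()) := fun j => by
        have := hγA j
        simp only [mulVec, dotProduct, transpose_apply, of_apply, Fintype.sum_sum_type,
          Finset.univ_unique, Finset.sum_singleton, Pi.zero_apply] at this
        change ∑ i, A i j * γ (Sum.inl i) + -c j * γ (Sum.inr ()) ≤ 0 at this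
        linarith
      have hval : (Sum.elim w fun _ => -z) ⬝ᵥ γ =
          w ⬝ᵥ (fun i => γ (Sum.inl i)) - z * γ (Sum.inr ()) := by
        simp [dotProduct, sub_eq_add_neg]
      rw [hval]
      have hnn : 0 ≤ fun i => γ (Sum.inl i) := fun i => hγ (Sum.inl i)
      -- A zero multiplier of the cost row leaves weak duality with zero cost; a positive one allows
      -- rescaling to a point of the dual.
      rcases (hγ (Sum.inr ())).eq_or_lt with h0 | hpos
      · have h0 : γ (Sum.inr ()) = 0 := h0.symm
        obtain ⟨y, hy, hwy⟩ := hne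
        have := dotProduct_le_dotProduct_of_dual (c := 0) hy hwy hnn (fun j => by
          have := hγA j
          rw [h0, mul_zero] at this
          simpa [mulVec, dotProduct] using this)
        rw [zero_dotProduct] at this
        rw [h0]
        linarith
      · have hpos : 0 < γ (Sum.inr ()) := hpos
        have := hcon ((γ (Sum.inr ()))⁻¹ • fun i => γ (Sum.inl i))
          (smul_nonneg (inv_nonneg.2 hpos.le) hnn) (fun j => by
            rw [mulVec_smul, Pi.smul_apply, smul_eq_mul, inv_mul_le_iff₀ hpos, mul_comm]
            simpa [mulVec, dotProduct] using hγA j)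
        rw [dotProduct_smul, smul_eq_mul, inv_mul_le_iff₀ hpos] at this
        linarith)
  have h₁ : w ≤ A *ᵥ y := fun i => hwy (Sum.inl i)
  have h₂ := hwy (Sum.inr ())
  have h₃ : (Matrix.of (Sum.elim A fun _ : Unit => -c) *ᵥ y) (Sum.inr ()) = -(c ⬝ᵥ y) :=
    neg_dotProduct c y
  rw [h₃, Sum.elim_inr] at h₂
  linarith [hz y hy h₁]

end MatrixInequalities

/-! ### Equivalence of programs and the epigraph form. -/

namespace MinProgram

variable {V Z W : Type*}

/-- Programs in `x` only that have the same feasible decisions and agree on these are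
equivalent. -/
theorem Equivalent.of_eqOn {P Q : MinProgram V Z} (hfeas : P.feasible = Q.feasible)
    (hobj : ∀ p ∈ P.feasible, P.objective p = Q.objective p) : P.Equivalent Q := by
  refine ⟨?_, fun x => exists_congr fun z => ?_⟩
  · simp only [optValue, ← hfeas]
    exact iInf_congr fun p => iInf_congr (hobj p)
  · simp only [IsOptimal, ← hfeas]
    refine and_congr_right fun hx => forall₂_congr fun q hq => ?_
    rw [hobj _ hx, hobj q hq]

theorem Equivalent.trans {U : Type*} {P : MinProgram V Z} {Q : MinProgram V W}
    {S : MinProgram V U} (h₁ : P.Equivalent Q) (h₂ : Q.Equivalent S) : P.Equivalent S :=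
  ⟨h₁.1.trans h₂.1, fun x => (h₁.2 x).trans (h₂.2 x)⟩

/-- A program is equivalent to its epigraph reformulation. -/
theorem equivalent_epigraph {P : MinProgram V Unit} {Q : MinProgram V ℝ} (X : Set V) (c : V → ℝ)
    (f : V → EReal) (hf : ∀ x ∈ X, f x ≠ ⊥) (hP : P.feasible = {p | p.1 ∈ X ∧ f p.1 ≠ ⊤})
    (hPobj : ∀ p, P.objective p = (c p.1 : EReal) + f p.1)
    (hQ : Q.feasible = {p | p.1 ∈ X ∧ f p.1 ≤ (p.2 : EReal)})
    (hQobj : ∀ p, Q.objective p = ((c p.1 + p.2 : ℝ) : EReal)) : P.Equivalent Q := by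
  have hPQ : ∀ p ∈ P.feasible, ∃ η : ℝ, f p.1 = η ∧ (p.1, η) ∈ Q.feasible ∧
      P.objective p = Q.objective (p.1, η) := by
    intro p hp
    rw [hP] at hp
    have hη := EReal.coe_toReal hp.2 (hf _ hp.1)
    refine ⟨(f p.1).toReal, hη.symm, ?_, ?_⟩
    · rw [hQ]
      exact ⟨hp.1, hη.ge⟩
    · rw [hPobj, hQobj, EReal.coe_add, hη]
  have hQP : ∀ p ∈ Q.feasible, (p.1, ()) ∈ P.feasible ∧
      P.objective (p.1, ()) ≤ Q.objective p := by
    intro p hp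
    rw [hQ] at hp
    refine ⟨?_, ?_⟩
    · rw [hP]
      exact ⟨hp.1, ne_top_of_le_ne_top (EReal.coe_ne_top _) hp.2⟩
    · rw [hPobj, hQobj, EReal.coe_add]
      exact add_le_add le_rfl hp.2
  refine ⟨le_antisymm (le_iInf₂ fun p hp => ?_) (le_iInf₂ fun p hp => ?_), fun x => ⟨?_, ?_⟩⟩
  · exact (iInf₂_le _ (hQP p hp).1).trans (hQP p hp).2
  · obtain ⟨η, -, hη, hobj⟩ := hPQ p hp
    rw [hobj]
    exact iInf₂_le _ hη
  · rintro ⟨⟨⟩, hx, hopt⟩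
    obtain ⟨η, -, hη, hobj⟩ := hPQ _ hx
    refine ⟨η, hη, fun q hq => ?_⟩
    rw [← hobj]
    exact (hopt _ (hQP q hq).1).trans (hQP q hq).2
  · rintro ⟨η, hx, hopt⟩
    refine ⟨(), (hQP _ hx).1, fun q hq => ?_⟩
    obtain ⟨η', -, hη', hobj⟩ := hPQ q hq
    rw [hobj]
    exact (hQP _ hx).2.trans (hopt _ hη')

end MinProgram

/-! ### Application to the two-stage problem. -/

namespace TwoStageRO

variable {mx nx nu ny kx ku ky : ℕ} (D : TwoStageRO mx nx nu ny kx ku ky)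

theorem dualPolyhedron_eq :
    D.dualPolyhedron = {π | ∀ i, dualFunctional D.B₂ i π ≤ Sum.elim D.c₂ 0 i} := by
  ext π
  exact (forall_dualFunctional_le D.B₂ D.c₂ π).symm

/-- The sum of the coordinates is positive on the nonzero elements of the recession cone of the
dual polyhedron. -/
theorem sum_proj_pos (γ : Fin ky → ℝ) (hγ : ∀ i, dualFunctional D.B₂ i γ ≤ 0) (h0 : γ ≠ 0) :
    0 < (∑ i, LinearMap.proj i : (Fin ky → ℝ) →ₗ[ℝ] ℝ) γ := by
  have hnn := ((forall_dualFunctional_nonpos D.B₂ γ).1 hγ).1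
  obtain ⟨i, hi⟩ := Function.ne_iff.1 h0
  rw [LinearMap.sum_apply]
  exact Finset.sum_pos' (fun j _ => hnn j)
    ⟨i, Finset.mem_univ i, lt_of_le_of_ne (hnn i) (Ne.symm hi)⟩

theorem isCompact_uncertainty {x : Fin mx ⊕ Fin nx → ℝ}
    (hbdd : Bornology.IsBounded (D.uncertainty x)) : IsCompact (D.uncertainty x) := by
  refine Metric.isCompact_of_isClosed_isBounded ?_ hbdd
  have hcont : Continuous fun u => D.F x *ᵥ u :=
    Continuous.matrix_mulVec continuous_const continuous_id
  exact (isClosed_le continuous_const continuous_id).inter (isClosed_le hcont continuous_const)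

/-- The lower-level linear programs attain their maxima. -/
theorem exists_innerLP_eq {x : Fin mx ⊕ Fin nx → ℝ} (hne : (D.uncertainty x).Nonempty)
    (hbdd : Bornology.IsBounded (D.uncertainty x)) (β : Fin ky → ℝ) :
    ∃ u ∈ D.uncertainty x, D.innerLP x β = (((-(D.E *ᵥ u)) ⬝ᵥ β : ℝ) : EReal) := by
  have hcont : Continuous fun u => (-(D.E *ᵥ u)) ⬝ᵥ β :=
    (Continuous.matrix_mulVec continuous_const continuous_id).neg.dotProduct continuous_const
  obtain ⟨u, hu, hmax⟩ :=
    (D.isCompact_uncertainty hbdd).exists_isMaxOn hne hcont.continuousOn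
  refine ⟨u, hu, le_antisymm (iSup₂_le fun v hv => ?_) ?_⟩
  · exact EReal.coe_le_coe_iff.2 (hmax hv)
  · exact le_iSup₂ (f := fun u _ => (((-(D.E *ᵥ u)) ⬝ᵥ β : ℝ) : EReal)) u hu

/-- A constraint of the enumeration formulation, written out for all scenarios. -/
theorem add_innerLP_le_iff {x : Fin mx ⊕ Fin nx → ℝ} (hne : (D.uncertainty x).Nonempty)
    (hbdd : Bornology.IsBounded (D.uncertainty x)) (β : Fin ky → ℝ) (η : ℝ) :
    (((D.d - D.B₁ *ᵥ x) ⬝ᵥ β : ℝ) : EReal) + D.innerLP x β ≤ (η : EReal) ↔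
      ∀ u ∈ D.uncertainty x, (D.d - D.B₁ *ᵥ x - D.E *ᵥ u) ⬝ᵥ β ≤ η := by
  have hsplit : ∀ u, (D.d - D.B₁ *ᵥ x - D.E *ᵥ u) ⬝ᵥ β =
      (D.d - D.B₁ *ᵥ x) ⬝ᵥ β + (-(D.E *ᵥ u)) ⬝ᵥ β := fun u => by
    rw [← add_dotProduct, ← sub_eq_add_neg]
  obtain ⟨u, hu, heq⟩ := D.exists_innerLP_eq hne hbdd β
  rw [heq, ← EReal.coe_add, EReal.coe_le_coe_iff]
  refine ⟨fun h v hv => ?_, fun h => by rw [← hsplit]; exact h u hu⟩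
  have hle : (((-(D.E *ᵥ v)) ⬝ᵥ β : ℝ) : EReal) ≤ D.innerLP x β :=
    le_iSup₂ (f := fun u _ => (((-(D.E *ᵥ u)) ⬝ᵥ β : ℝ) : EReal)) v hv
  rw [heq, EReal.coe_le_coe_iff] at hle
  rw [hsplit]
  linarith

theorem bilinearValue_le_iff (x : Fin mx ⊕ Fin nx → ℝ) (η : ℝ) :
    D.bilinearValue x ≤ (η : EReal) ↔ ∀ u ∈ D.uncertainty x, ∀ π ∈ D.dualPolyhedron,
      (D.d - D.B₁ *ᵥ x - D.E *ᵥ u) ⬝ᵥ π ≤ η := by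
  simp only [bilinearValue, iSup_le_iff, EReal.coe_le_coe_iff]

/-- If the relaxation has a finite optimal value, the dual of the recourse problem is feasible. -/
theorem dualPolyhedron_nonempty
    (h : D.relaxation.optValue ≠ ⊤ ∧ D.relaxation.optValue ≠ ⊥) : D.dualPolyhedron.Nonempty := by
  have hfeas : D.relaxation.feasible.Nonempty := by
    rw [Set.nonempty_iff_ne_empty]
    intro h0
    exact h.1 (by simp [MinProgram.optValue, h0])
  obtain ⟨⟨x, u, y⟩, hx, hu, hy⟩ := hfeas
  set r := D.relaxation.optValue.toReal with hr
  have hle : ∀ y ∈ D.recourse x u, r ≤ D.c₁ ⬝ᵥ x + D.c₂ ⬝ᵥ y := fun y hy => by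
    rw [← EReal.coe_le_coe_iff, hr, EReal.coe_toReal h.1 h.2]
    exact iInf₂_le (f := fun p (_ : p ∈ D.relaxation.feasible) => D.relaxation.objective p)
      (x, u, y) ⟨hx, hu, hy⟩
  obtain ⟨π, hπ, hπc, -⟩ := exists_dual_gt (A := D.B₂) (w := D.d - D.B₁ *ᵥ x - D.E *ᵥ u)
    (c := D.c₂) (z := r - D.c₁ ⬝ᵥ x - 1) ⟨y, hy⟩
    (fun y hy hwy => by linarith [hle y ⟨hy, hwy⟩])
  exact ⟨π, hπ, hπc⟩

/-- Strong duality for the recourse problem. -/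
theorem recourseValue_eq {x : Fin mx ⊕ Fin nx → ℝ} {u : Fin nu → ℝ}
    (hne : (D.recourse x u).Nonempty) :
    D.recourseValue x u =
      ⨆ π ∈ D.dualPolyhedron, (((D.d - D.B₁ *ᵥ x - D.E *ᵥ u) ⬝ᵥ π : ℝ) : EReal) := by
  refine le_antisymm ?_ (iSup₂_le fun π hπ => le_iInf₂ fun y hy => ?_)
  · by_contra! hlt
    obtain ⟨z, hz, hz'⟩ := EReal.lt_iff_exists_real_btwn.1 hlt
    obtain ⟨π, hπ, hπc, hzπ⟩ := exists_dual_gt hne fun y hy hwy =>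
      EReal.coe_lt_coe_iff.1 (hz'.trans_le (iInf₂_le
        (f := fun y (_ : y ∈ D.recourse x u) => ((D.c₂ ⬝ᵥ y : ℝ) : EReal)) y ⟨hy, hwy⟩))
    refine absurd (EReal.coe_lt_coe_iff.2 hzπ) (not_lt.2 (le_trans ?_ hz.le))
    exact le_iSup₂_of_le π ⟨hπ, hπc⟩ le_rfl
  · exact EReal.coe_le_coe_iff.2 (dotProduct_le_dotProduct_of_dual hy.1 hy.2 hπ.1 hπ.2)

/-- Farkas' lemma in one direction, weak duality with zero cost in the other. -/
theorem recourse_nonempty_iff (x : Fin mx ⊕ Fin nx → ℝ) (u : Fin nu → ℝ) :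
    (D.recourse x u).Nonempty ↔
      ∀ γ, (∀ i, dualFunctional D.B₂ i γ ≤ 0) → (D.d - D.B₁ *ᵥ x - D.E *ᵥ u) ⬝ᵥ γ ≤ 0 := by
  constructor
  · rintro ⟨y, hy, hwy⟩ γ hγ
    obtain ⟨h₁, h₂⟩ := (forall_dualFunctional_nonpos D.B₂ γ).1 hγ
    simpa using dotProduct_le_dotProduct_of_dual hy hwy h₁ h₂
  · exact fun h => exists_nonneg_le_mulVec D.B₂ _ fun γ h₁ h₂ =>
      h γ ((forall_dualFunctional_nonpos D.B₂ γ).2 ⟨h₁, h₂⟩)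

variable {D}

/-- If the bilinear value is bounded above then the recourse problem is always feasible. -/
theorem recourse_nonempty_of_bilinearValue_le (hdual : D.dualPolyhedron.Nonempty)
    {x : Fin mx ⊕ Fin nx → ℝ} {η : ℝ} (hη : D.bilinearValue x ≤ (η : EReal))
    {u : Fin nu → ℝ} (hu : u ∈ D.uncertainty x) : (D.recourse x u).Nonempty := by
  rw [recourse_nonempty_iff]
  intro γ hγ
  obtain ⟨π, hπ⟩ := hdual
  rw [bilinearValue_le_iff] at hη
  by_contra! hpos
  set w := D.d - D.B₁ *ᵥ x - D.E *ᵥ u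
  have hrec : γ ∈ recessionCone D.dualPolyhedron := by
    rw [dualPolyhedron_eq] at hπ ⊢
    rw [recessionCone_eq _ _ ⟨π, hπ⟩]
    exact hγ
  have hle : w ⬝ᵥ π ≤ η := hη u hu π hπ
  have := hη u hu _ (hrec π hπ ((η - w ⬝ᵥ π + 1) / (w ⬝ᵥ γ))
    (div_nonneg (by linarith) hpos.le))
  rw [dotProduct_add, dotProduct_smul, smul_eq_mul, div_mul_cancel₀ _ hpos.ne'] at this
  linarith

/-- The optimality and feasibility constraints describe the epigraph of the bilinear value. -/
theorem constraints_iff_bilinearValue_le (hdual : D.dualPolyhedron.Nonempty)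
    {R : Set (Fin ky → ℝ)} (hR : IsExtremeRaySet D.dualPolyhedron R)
    {x : Fin mx ⊕ Fin nx → ℝ} (hne : (D.uncertainty x).Nonempty)
    (hbdd : Bornology.IsBounded (D.uncertainty x)) (η : ℝ) :
    ((∀ π ∈ D.dualPolyhedron.extremePoints ℝ,
        (((D.d - D.B₁ *ᵥ x) ⬝ᵥ π : ℝ) : EReal) + D.innerLP x π ≤ (η : EReal)) ∧
      ∀ γ ∈ R, (((D.d - D.B₁ *ᵥ x) ⬝ᵥ γ : ℝ) : EReal) + D.innerLP x γ ≤ 0) ↔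
    D.bilinearValue x ≤ (η : EReal) := by
  -- Reading `0` as a real number lets one lemma unfold both families of constraints.
  simp only [← EReal.coe_zero, D.add_innerLP_le_iff hne hbdd]
  constructor
  · rintro ⟨hP, hRay⟩
    rw [bilinearValue_le_iff]
    intro u hu π hπ
    rw [dualPolyhedron_eq] at hR hπ hP
    -- Pointedness: otherwise the coordinate sum would be positive at both `δ` and `-δ`.
    obtain ⟨p, hp, hle⟩ := exists_extremePoint_ge _ _ (fun δ hδ => by
        by_contra hδ0
        have h₁ := D.sum_proj_pos δ (fun i => (hδ i).le) hδ0
        have h₂ := D.sum_proj_pos (-δ) (fun i => by simp [hδ i]) (neg_ne_zero.2 hδ0)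
        rw [map_neg] at h₂
        linarith) (dotProductEquiv ℝ (Fin ky) (D.d - D.B₁ *ᵥ x - D.E *ᵥ u))
      (fun δ hδ => hR.nonpos_of_forall_nonpos D.sum_proj_pos ⟨π, hπ⟩ _
        (fun γ hγ => by simpa using hRay γ hγ u hu) hδ) π hπ
    exact (by simpa using hle : _ ⬝ᵥ π ≤ _ ⬝ᵥ p).trans (hP p hp u hu)
  · intro h
    refine ⟨fun π hπ u hu => (D.bilinearValue_le_iff x η).1 h u hu π hπ.1, fun γ hγ u hu => ?_⟩
    have hγR := hR.1 γ hγ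
    rw [dualPolyhedron_eq, GeneratesExtremeRay,
      recessionCone_eq _ _ (by rwa [← dualPolyhedron_eq])] at hγR
    exact (D.recourse_nonempty_iff x u).1
      (recourse_nonempty_of_bilinearValue_le hdual h hu) γ hγR.1

/-- Excludes `-∞`, which no real `η` could represent in the epigraph form. -/
theorem bilinearValue_ne_bot (hdual : D.dualPolyhedron.Nonempty) {x : Fin mx ⊕ Fin nx → ℝ}
    (hne : (D.uncertainty x).Nonempty) : D.bilinearValue x ≠ ⊥ := by
  obtain ⟨π, hπ⟩ := hdual
  obtain ⟨u, hu⟩ := hne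
  refine ne_bot_of_le_ne_bot (EReal.coe_ne_bot ((D.d - D.B₁ *ᵥ x - D.E *ᵥ u) ⬝ᵥ π)) ?_
  exact le_iSup₂_of_le u hu (le_iSup₂_of_le π hπ le_rfl)

/-- A decision admits a recourse in all scenarios iff its bilinear value is finite. -/
theorem forall_recourse_nonempty_iff (hdual : D.dualPolyhedron.Nonempty)
    {R : Set (Fin ky → ℝ)} (hR : IsExtremeRaySet D.dualPolyhedron R)
    {x : Fin mx ⊕ Fin nx → ℝ} (hne : (D.uncertainty x).Nonempty)
    (hbdd : Bornology.IsBounded (D.uncertainty x)) :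
    (∀ u ∈ D.uncertainty x, (D.recourse x u).Nonempty) ↔ D.bilinearValue x ≠ ⊤ := by
  constructor
  · intro h
    choose v _ hv using D.exists_innerLP_eq hne hbdd
    have hfin : (D.dualPolyhedron.extremePoints ℝ).Finite := by
      rw [dualPolyhedron_eq]
      exact finite_extremePoints _ _
    -- `η` bounds the finitely many inner maxima, attained at `v π`, so all optimality constraints
    -- hold.
    obtain ⟨η, hη⟩ := (hfin.image fun π =>
      (D.d - D.B₁ *ᵥ x) ⬝ᵥ π + (-(D.E *ᵥ v π)) ⬝ᵥ π).bddAbove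
    refine ne_top_of_le_ne_top (EReal.coe_ne_top η)
      ((constraints_iff_bilinearValue_le hdual hR hne hbdd η).1 ⟨fun π hπ => ?_, fun γ hγ => ?_⟩)
    · rw [hv, ← EReal.coe_add, EReal.coe_le_coe_iff]
      exact hη (Set.mem_image_of_mem _ hπ)
    · rw [← EReal.coe_zero, D.add_innerLP_le_iff hne hbdd]
      intro u hu
      have hγR := hR.1 γ hγ
      rw [dualPolyhedron_eq, GeneratesExtremeRay,
        recessionCone_eq _ _ (by rwa [← dualPolyhedron_eq])] at hγR
      exact (D.recourse_nonempty_iff x u).1 (h u hu) γ hγR.1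
  · intro h u hu
    exact recourse_nonempty_of_bilinearValue_le hdual
      (EReal.coe_toReal h (bilinearValue_ne_bot hdual hne)).ge hu

/-- The bilinear bilevel program is equivalent to the enumeration formulation. -/
theorem bilinearBilevel_equivalent (hdual : D.dualPolyhedron.Nonempty)
    {R : Set (Fin ky → ℝ)} (hR : IsExtremeRaySet D.dualPolyhedron R)
    (hne : ∀ x ∈ D.firstStage, (D.uncertainty x).Nonempty)
    (hbdd : ∀ x ∈ D.firstStage, Bornology.IsBounded (D.uncertainty x)) :
    D.bilinearBilevel.Equivalent (D.enumeration (D.dualPolyhedron.extremePoints ℝ) R) := by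
  refine MinProgram.equivalent_epigraph D.firstStage (fun x => D.c₁ ⬝ᵥ x) D.bilinearValue
    (fun x hx => bilinearValue_ne_bot hdual (hne x hx)) rfl (fun _ => rfl) ?_ (fun _ => rfl)
  ext ⟨x, η⟩
  exact and_congr_right fun hx =>
    constraints_iff_bilinearValue_le hdual hR (hne x hx) (hbdd x hx) η

/-- The two-stage problem is equivalent to the bilinear bilevel program. -/
theorem twoStage_equivalent_bilinearBilevel (hdual : D.dualPolyhedron.Nonempty)
    {R : Set (Fin ky → ℝ)} (hR : IsExtremeRaySet D.dualPolyhedron R)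
    (hne : ∀ x ∈ D.firstStage, (D.uncertainty x).Nonempty)
    (hbdd : ∀ x ∈ D.firstStage, Bornology.IsBounded (D.uncertainty x)) :
    D.twoStage.Equivalent D.bilinearBilevel := by
  refine MinProgram.Equivalent.of_eqOn (Set.ext fun p => and_congr_right fun hx =>
    forall_recourse_nonempty_iff hdual hR (hne _ hx) (hbdd _ hx)) fun p hp => ?_
  have : ⨆ u ∈ D.uncertainty p.1, D.recourseValue p.1 u = D.bilinearValue p.1 :=
    iSup_congr fun u => iSup_congr fun hu =>
      D.recourseValue_eq (hp.2 u hu)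
  exact congrArg (((D.c₁ ⬝ᵥ p.1 : ℝ) : EReal) + ·) this

end TwoStageRO

theorem mainTheorem3 {mx nx nu ny kx ku ky : ℕ} (D : TwoStageRO mx nx nu ny kx ku ky)
    (hA1 : ∀ x ∈ D.firstStage, (D.uncertainty x).Nonempty)
    (hA2 : ∀ x ∈ D.firstStage, Bornology.IsBounded (D.uncertainty x))
    (hA3 : D.relaxation.optValue ≠ ⊤ ∧ D.relaxation.optValue ≠ ⊥)
    (R : Set (Fin ky → ℝ)) (hR : IsExtremeRaySet D.dualPolyhedron R) :
    (D.dualPolyhedron.extremePoints ℝ).Finite ∧ R.Finite ∧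
    (∀ x ∈ D.firstStage, ∀ β : Fin ky → ℝ, ∃ u ∈ D.uncertainty x,
      D.innerLP x β = (((-(D.E *ᵥ u)) ⬝ᵥ β : ℝ) : EReal)) ∧
    D.twoStage.Equivalent (D.enumeration (D.dualPolyhedron.extremePoints ℝ) R) ∧
    D.bilinearBilevel.Equivalent (D.enumeration (D.dualPolyhedron.extremePoints ℝ) R) := by
  have hdual := D.dualPolyhedron_nonempty hA3
  have hbil := TwoStageRO.bilinearBilevel_equivalent hdual hR hA1 hA2
  refine ⟨?_, ?_, fun x hx => D.exists_innerLP_eq (hA1 x hx) (hA2 x hx),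
    (TwoStageRO.twoStage_equivalent_bilinearBilevel hdual hR hA1 hA2).trans hbil, hbil⟩
  · rw [TwoStageRO.dualPolyhedron_eq]
    exact finite_extremePoints _ _
  · rw [TwoStageRO.dualPolyhedron_eq] at hR hdual
    exact hR.finite D.sum_proj_pos hdual
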